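/- Let $n \ge 1$ and $k \ge 2$ be integers. Let $\mathrm{Sp}(n,1)$ be the group of all invertible $(n+1)\times(n+1)$ matrices $A$ over the quaternions $\mathbb{H}$ that preserve the Hermitian form $\langle z, w\rangle = \bar w_{n+1} z_1 + \sum_{i=2}^{n} \bar w_i z_i + \bar w_1 z_{n+1}$ on the right $\mathbb{H}$-module $\mathbb{H}^{n+1}$, and let $\mathrm{PSp}(n,1) = \mathrm{Sp}(n,1)/\{\pm I\}$, with its usual topology as a Lie group. A $k$-tuple $(g_1,\dots,g_k)$ of elements of a group $G$ is called strongly $k$-reversible if there is an element $h \in G$ with $h^2 = 1$ such that $h g_i h^{-1} = g_i^{-1}$ for all $i = 1,\dots,k$. Then the set of strongly $k$-reversible tuples in $\mathrm{PSp}(n,1)$ has Haar measure zero in the product group $\mathrm{PSp}(n,1)^k$. -/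

import Mathlib

open scoped Quaternion Matrix

noncomputable section

/-- The matrix `H₁` of the Hermitian form
`⟨z, w⟩ = w^* H₁ z = conj w_{n+1} z_1 + ∑_{i=2}^n conj w_i z_i + conj w_1 z_{n+1}`
on the right `ℍ`-module `ℍ^{n+1}`, for `n ≥ 1` (coordinates are numbered `0, …, n` here).
It exchanges the first and the last coordinate and fixes the others; the form has
signature `(n, 1)`. -/
def formMatrix (n : ℕ) : Matrix (Fin (n + 1)) (Fin (n + 1)) ℍ[ℝ] :=
  Matrix.of fun i j => if j = Equiv.swap 0 (Fin.last n) i then 1 else 0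

/-- The group `Sp(n,1)` of invertible quaternionic matrices that preserve the Hermitian form with
matrix `H₁`, i.e. that satisfy `A^* H₁ A = H₁`. -/
def SpGroup (n : ℕ) : Subgroup (Matrix (Fin (n + 1)) (Fin (n + 1)) ℍ[ℝ])ˣ where
  carrier := {A | (A : Matrix (Fin (n + 1)) (Fin (n + 1)) ℍ[ℝ])ᴴ * formMatrix n *
    (A : Matrix (Fin (n + 1)) (Fin (n + 1)) ℍ[ℝ]) = formMatrix n}
  one_mem' := by simp
  mul_mem' := by
    intro A B hA hB
    simp only [Set.mem_ofPred_eq] at hA hB ⊢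
    rw [Units.val_mul, Matrix.conjTranspose_mul]
    calc (B.val)ᴴ * (A.val)ᴴ * formMatrix n * (A.val * B.val)
        = (B.val)ᴴ * ((A.val)ᴴ * formMatrix n * A.val) * B.val := by simp only [Matrix.mul_assoc]
      _ = formMatrix n := by rw [hA, hB]
  inv_mem' := by
    intro A hA
    simp only [Set.mem_ofPred_eq] at hA ⊢
    have h1 : A.val * (A⁻¹).val = 1 := A.mul_inv
    have h2 : ((A⁻¹).val)ᴴ * (A.val)ᴴ = 1 := by
      rw [← Matrix.conjTranspose_mul, h1, Matrix.conjTranspose_one]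
    calc ((A⁻¹).val)ᴴ * formMatrix n * (A⁻¹).val
        = ((A⁻¹).val)ᴴ * ((A.val)ᴴ * formMatrix n * A.val) * (A⁻¹).val := by rw [hA]
      _ = (((A⁻¹).val)ᴴ * (A.val)ᴴ) * formMatrix n * (A.val * (A⁻¹).val) := by
          simp only [Matrix.mul_assoc]
      _ = formMatrix n := by rw [h1, h2, Matrix.one_mul, Matrix.mul_one]

/-- The subgroup `{I, -I}` of `Sp(n,1)`. -/
def plusMinusOne (n : ℕ) : Subgroup (SpGroup n) where
  carrier := {A | (A : (Matrix (Fin (n + 1)) (Fin (n + 1)) ℍ[ℝ])ˣ) = 1 ∨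
    (A : (Matrix (Fin (n + 1)) (Fin (n + 1)) ℍ[ℝ])ˣ) = -1}
  one_mem' := Or.inl rfl
  mul_mem' := by
    rintro A B (hA | hA) (hB | hB)
    · left; rw [Subgroup.coe_mul, hA, hB, one_mul]
    · right; rw [Subgroup.coe_mul, hA, hB, one_mul]
    · right; rw [Subgroup.coe_mul, hA, hB, mul_one]
    · left; rw [Subgroup.coe_mul, hA, hB, neg_mul_neg, one_mul]
  inv_mem' := by
    rintro A (hA | hA)
    · left; rw [Subgroup.coe_inv, hA, inv_one]
    · right; rw [Subgroup.coe_inv, hA, inv_neg, inv_one]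

instance plusMinusOne_normal (n : ℕ) : (plusMinusOne n).Normal where
  conj_mem := by
    rintro A (hA | hA) B
    · left; simp [hA]
    · right; simp [hA]

/-- `PSp(n,1) = Sp(n,1) / {I, -I}`. -/
def PSpGroup (n : ℕ) : Type := SpGroup n ⧸ plusMinusOne n

instance (n : ℕ) : Group (PSpGroup n) :=
  inferInstanceAs (Group (SpGroup n ⧸ plusMinusOne n))

/-- The quotient topology, where `Sp(n,1)` has the topology of a matrix group. -/
instance (n : ℕ) : TopologicalSpace (PSpGroup n) :=
  inferInstanceAs (TopologicalSpace (SpGroup n ⧸ plusMinusOne n))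

instance (n : ℕ) : IsTopologicalGroup (PSpGroup n) :=
  inferInstanceAs (IsTopologicalGroup (SpGroup n ⧸ plusMinusOne n))

instance (n : ℕ) : MeasurableSpace (PSpGroup n) := borel (PSpGroup n)

instance (n : ℕ) : BorelSpace (PSpGroup n) := ⟨rfl⟩

/-- A tuple `(g_1, …, g_k)` in a group `G` is strongly `k`-reversible if some `h : G` with
`h ^ 2 = 1` conjugates it simultaneously to `(g_1⁻¹, …, g_k⁻¹)`. -/
def IsStronglyReversible {G : Type*} [Group G] {k : ℕ} (g : Fin k → G) : Prop :=
  ∃ h : G, h ^ 2 = 1 ∧ ∀ i, h * g i * h⁻¹ = (g i)⁻¹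

end

-- Reversal of a pair is detected by one function. Take the words ABA²B² and B²A²BA, which are each
-- other's reversals. In Sp(n,1) the inverse of A is HA*H, so the real part of the trace is
-- invariant under inversion as well as conjugation. Hence replacing (A, B) by (A⁻¹, B⁻¹) exchanges
-- the two real traces. The difference of their squares, `reversalPoly`, changes sign under
-- simultaneous inversion and is conjugation invariant. The squares absorb the signs of lifts, so it
-- descends to PSp(n,1) and vanishes on every reversible pair. It is not identically zero: a pair in
-- Sp(1,1), extended by the identity, shows this.
--
-- It remains to see that its zero set Z is null. Instead of analytic structure on the group, the
-- proof uses generating curves along which the function is real analytic: each translate of such a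
-- curve stays in Z or meets it at almost no time. By Fubini and left invariance, almost every point
-- of Z keeps its whole orbit under a given curve inside Z. The smallest closed set that contains
-- almost all of Z and has the same dichotomy is therefore stable under all curves, hence under the
-- group. Being contained in a proper subset, it is empty, and Z is null
-- (`measure_eq_zero_of_curve_dichotomy`).
--
-- The curves consist of quasi-reflections, and a Cartan–Dieudonné argument (`mem_reflectionMonoid`)
-- shows that they generate Sp(n,1).

universe u

/-! ### Null sets from curve dichotomies -/

open MeasureTheory in
/-- Let `Z` be a closed set and `γ` a curve through `1` such that every translate of `γ` lies
in `Z` for all times or for almost no time. Then almost every point of `Z` stays in `Z` when it is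
moved along `γ`. -/
theorem ae_forall_curve_mul_mem {G : Type*} [Group G] [TopologicalSpace G] [IsTopologicalGroup G]
    [SecondCountableTopology G] [MeasurableSpace G] [BorelSpace G] (μ : Measure G) [SFinite μ]
    [μ.IsMulLeftInvariant] {γ : ℝ → G} (hγ : Continuous γ) (h1 : γ 0 = 1) {Z : Set G}
    (hZ : IsClosed Z) (h : ∀ x, (∀ t, γ t * x ∈ Z) ∨ ∀ᵐ t, γ t * x ∉ Z) :
    ∀ᵐ z ∂μ, z ∈ Z → ∀ t, γ t * z ∈ Z := by
  have hB : IsClosed {x | ∀ t, γ t * x ∈ Z} := by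
    rw [Set.ofPred_forall]
    exact isClosed_iInter fun t => hZ.preimage (continuous_const_mul (γ t))
  set B : Set G := {x | ∀ t, γ t * x ∈ Z} with hBdef
  have hc : Continuous fun p : ℝ × G => γ p.1 * p.2 := by fun_prop
  have hc' : Continuous fun p : ℝ × G => (γ p.1)⁻¹ * p.2 := by fun_prop
  have hm1 : MeasurableSet {p : ℝ × G | γ p.1 * p.2 ∈ Z → p.2 ∈ B} :=
    (hZ.preimage hc).measurableSet.imp (hB.preimage continuous_snd).measurableSet
  have hm2 : MeasurableSet {p : ℝ × G | p.2 ∈ Z → (γ p.1)⁻¹ * p.2 ∈ B} :=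
    (hZ.preimage continuous_snd).measurableSet.imp (hB.preimage hc').measurableSet
  -- Fubini is applied twice, with the substitution z = γ(t)x in between; left invariance makes this
  -- substitution preserve null sets.
  have e1 : ∀ᵐ x ∂μ, ∀ᵐ t, γ t * x ∈ Z → x ∈ B := by
    refine .of_forall fun x => ?_
    rcases h x with hx | hx
    · exact .of_forall fun t _ => hx
    · filter_upwards [hx] with t ht ht' using (ht ht').elim
  have e2 : ∀ᵐ t, ∀ᵐ x ∂μ, γ t * x ∈ Z → x ∈ B :=
    (Measure.ae_ae_comm (μ := volume) (ν := μ) (p := fun t x => γ t * x ∈ Z → x ∈ B) hm1).2 e1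
  have e3 : ∀ᵐ t, ∀ᵐ x ∂μ, x ∈ Z → (γ t)⁻¹ * x ∈ B := by
    filter_upwards [e2] with t ht
    have := (measurePreserving_mul_left μ (γ t)⁻¹).quasiMeasurePreserving.ae ht
    simpa using this
  have e4 : ∀ᵐ x ∂μ, ∀ᵐ t, x ∈ Z → (γ t)⁻¹ * x ∈ B :=
    (Measure.ae_ae_comm (μ := volume) (ν := μ)
      (p := fun t x => x ∈ Z → (γ t)⁻¹ * x ∈ B) hm2).1 e3
  filter_upwards [e4] with z hz hzZ
  -- A conull set of times is dense; since B is closed, the time 0 belongs to it too, which gives z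
  -- ∈ B.
  have hd : Dense {t : ℝ | (γ t)⁻¹ * z ∈ B} :=
    Measure.dense_of_ae (by filter_upwards [hz] with t ht using ht hzZ)
  have hcl : IsClosed {t : ℝ | (γ t)⁻¹ * z ∈ B} := hB.preimage (by fun_prop)
  have : (0 : ℝ) ∈ {t : ℝ | (γ t)⁻¹ * z ∈ B} := by
    rw [← hcl.closure_eq, hd.closure_eq]; trivial
  simpa only [Set.mem_ofPred_eq, h1, inv_one, one_mul] using! this

open MeasureTheory in
/-- A closed set which every translate of certain curves through `1` meets for all times or for
almost no time is null or everything, if these curves generate the group. -/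
theorem measure_eq_zero_of_curve_dichotomy {G : Type u} [Group G] [TopologicalSpace G]
    [IsTopologicalGroup G] [SecondCountableTopology G] [MeasurableSpace G] [BorelSpace G]
    (μ : Measure G) [SFinite μ] [μ.IsMulLeftInvariant] {Γ : Set (ℝ → G)}
    (hΓ : ∀ γ ∈ Γ, Continuous γ ∧ γ 0 = 1)
    (hgen : Submonoid.closure {g | ∃ γ ∈ Γ, ∃ t, γ t = g} = ⊤) {Z : Set G} (hZ : IsClosed Z)
    (h : ∀ γ ∈ Γ, ∀ g x, (∀ t, g * γ t * x ∈ Z) ∨ ∀ᵐ t, g * γ t * x ∉ Z) (hne : Z ≠ Set.univ) :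
    μ Z = 0 := by
  -- Two-sided translates make the dichotomy stable under preimages by left translations, as the
  -- minimality argument for `hinv` requires.
  let Q : Set (Set G) := {W | IsClosed W ∧ (∀ᵐ z ∂μ, z ∈ Z → z ∈ W) ∧
    ∀ γ ∈ Γ, ∀ g x, (∀ t, g * γ t * x ∈ W) ∨ ∀ᵐ t, g * γ t * x ∉ W}
  have hinter : ∀ {ι : Type u}  (W : ι → Set G),
      (∀ i, ∀ γ ∈ Γ, ∀ g x, (∀ t, g * γ t * x ∈ W i) ∨ ∀ᵐ t, g * γ t * x ∉ W i) →
      ∀ γ ∈ Γ, ∀ g x, (∀ t, g * γ t * x ∈ ⋂ i, W i) ∨ ∀ᵐ t, g * γ t * x ∉ ⋂ i, W i := by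
    intro ι W hW γ hγ g x
    by_cases hall : ∀ i t, g * γ t * x ∈ W i
    · left
      intro t
      exact Set.mem_iInter.2 fun i => hall i t
    · right
      push Not at hall
      obtain ⟨i, t, hi⟩ := hall
      have := (hW i γ hγ g x).resolve_left fun H => hi (H t)
      filter_upwards [this] with s hs hs'
      exact hs (Set.mem_iInter.1 hs' i)
  set Y : Set G := ⋂ W : Q, W.1 with hY
  have hYQ : Y ∈ Q := by
    refine ⟨isClosed_iInter fun W => W.2.1, ?_, hinter _ fun W => W.2.2.2⟩
    -- Second countability reduces the intersection to a countable one, so that the exceptional null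
    -- sets can be united.
    obtain ⟨T, hT, hTU⟩ := TopologicalSpace.isOpen_iUnion_countable
      (fun W : Q => (W.1)ᶜ) fun W => W.2.1.isOpen_compl
    have : ∀ᵐ z ∂μ, ∀ W ∈ T, z ∈ Z → z ∈ W.1 := (ae_ball_iff hT).2 fun W _ => W.2.2.1
    filter_upwards [this] with z hz hzZ
    rw [hY, ← compl_compl (⋂ W : Q, W.1), Set.compl_iInter, ← hTU]
    simp only [Set.mem_compl_iff, Set.mem_iUnion, not_exists, not_not]
    exact fun W hW => hz W hW hzZ
  have hinv : ∀ γ ∈ Γ, ∀ t, ∀ y ∈ Y, γ t * y ∈ Y := by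
    intro γ hγ t y hy
    -- The points of Y whose orbit under γ stays in Y form a member of Q, so by minimality they are
    -- all of Y. The lift only matches the universe of `hinter`.
    have hBQ : (⋂ t : ULift.{u} ℝ, (fun x => γ t.down * x) ⁻¹' Y) ∈ Q := by
      refine ⟨isClosed_iInter fun t => hYQ.1.preimage (continuous_const_mul (γ t.down)), ?_, ?_⟩
      · have := ae_forall_curve_mul_mem μ (hΓ γ hγ).1 (hΓ γ hγ).2 hYQ.1
          fun x => by simpa using hYQ.2.2 γ hγ 1 x
        filter_upwards [hYQ.2.1, this] with z hz hz' hzZ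
        exact Set.mem_iInter.2 fun t => hz' (hz hzZ) t.down
      · refine hinter _ fun s γ' hγ' g x => ?_
        simpa [mul_assoc] using hYQ.2.2 γ' hγ' (γ s.down * g) x
    exact Set.mem_iInter.1 (Set.mem_iInter.1 hy ⟨_, hBQ⟩) ⟨t⟩
  have hinv' : ∀ g : G, ∀ y ∈ Y, g * y ∈ Y := by
    intro g
    have hg : g ∈ Submonoid.closure {g | ∃ γ ∈ Γ, ∃ t, γ t = g} := hgen ▸ Submonoid.mem_top g
    induction hg using Submonoid.closure_induction with
    | mem x hx =>
      obtain ⟨γ, hγ, t, rfl⟩ := hx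
      exact hinv γ hγ t
    | one => simp
    | mul a b _ _ ha hb =>
      intro y hy
      rw [mul_assoc]
      exact ha _ (hb _ hy)
  have hYZ : Y ⊆ Z := Set.iInter_subset (fun W : Q => W.1) ⟨Z, hZ, .of_forall fun _ => id, h⟩
  have hYe : Y = ∅ := by
    by_contra hYe
    obtain ⟨y, hy⟩ := Set.nonempty_iff_ne_empty.2 hYe
    refine hne (Set.eq_univ_of_forall fun g => hYZ ?_)
    simpa using hinv' (g * y⁻¹) y hy
  have := hYQ.2.1
  rw [hYe] at this
  simpa [ae_iff] using this

/-- The zero set of a real analytic function on `ℝ` is everything or null. -/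
theorem AnalyticOnNhd.forall_eq_zero_or_ae_ne_zero {f : ℝ → ℝ} (hf : AnalyticOnNhd ℝ f Set.univ) :
    (∀ t, f t = 0) ∨ ∀ᵐ t, f t ≠ 0 := by
  by_cases h : ∀ t, f t = 0
  · exact .inl h
  · right
    push Not at h
    obtain ⟨x, hx⟩ := h
    have h1 := hf.preimage_zero_mem_codiscrete hx
    have h2 := ae_restrict_le_codiscreteWithin (μ := MeasureTheory.volume) MeasurableSet.univ h1
    rw [MeasureTheory.Measure.restrict_univ] at h2
    filter_upwards [h2] with t ht using ht

/-! ### The Hermitian form and inverses in Sp(n,1) -/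

theorem formMatrix_conjTranspose (n : ℕ) : (formMatrix n)ᴴ = formMatrix n := by
  ext i j : 1
  have : (i = Equiv.swap 0 (Fin.last n) j) ↔ (j = Equiv.swap 0 (Fin.last n) i) := by
    constructor <;> rintro rfl <;> simp
  by_cases h : j = Equiv.swap 0 (Fin.last n) i <;>
    simp [formMatrix, Matrix.conjTranspose_apply, this, h]

theorem formMatrix_mul_apply {n : ℕ} {p : Type*} (A : Matrix (Fin (n + 1)) p ℍ[ℝ])
    (i : Fin (n + 1)) (j : p) :
    (formMatrix n * A) i j = A (Equiv.swap 0 (Fin.last n) i) j := by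
  simp [Matrix.mul_apply, formMatrix]

theorem formMatrix_mul_self (n : ℕ) : formMatrix n * formMatrix n = 1 := by
  ext i j : 1
  rw [formMatrix_mul_apply]
  simp [formMatrix, Matrix.one_apply, eq_comm]

/-- Matrices that preserve the form are invertible. -/
theorem form_adjoint_mul {n : ℕ} {A : Matrix (Fin (n + 1)) (Fin (n + 1)) ℍ[ℝ]}
    (hA : Aᴴ * formMatrix n * A = formMatrix n) : formMatrix n * Aᴴ * formMatrix n * A = 1 := by
  rw [Matrix.mul_assoc, Matrix.mul_assoc, ← Matrix.mul_assoc Aᴴ, hA, formMatrix_mul_self]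

theorem mul_form_adjoint {n : ℕ} {A : Matrix (Fin (n + 1)) (Fin (n + 1)) ℍ[ℝ]}
    (hA : Aᴴ * formMatrix n * A = formMatrix n) : A * (formMatrix n * Aᴴ * formMatrix n) = 1 :=
  mul_eq_one_symm (form_adjoint_mul hA)

noncomputable section

/-- The element of `Sp(n,1)` with a given form-preserving matrix. -/
def SpGroup.ofMatrix {n : ℕ} (A : Matrix (Fin (n + 1)) (Fin (n + 1)) ℍ[ℝ])
    (hA : Aᴴ * formMatrix n * A = formMatrix n) : SpGroup n :=
  ⟨⟨A, formMatrix n * Aᴴ * formMatrix n, mul_form_adjoint hA, form_adjoint_mul hA⟩, hA⟩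

/-- The inclusion of `Sp(n,1)` into the matrices. -/
def SpGroup.toMatrix (n : ℕ) : SpGroup n →* Matrix (Fin (n + 1)) (Fin (n + 1)) ℍ[ℝ] :=
  (Units.coeHom _).comp (SpGroup n).subtype

theorem SpGroup.toMatrix_injective (n : ℕ) : Function.Injective (SpGroup.toMatrix n) :=
  Units.val_injective.comp Subtype.val_injective

theorem SpGroup.toMatrix_form {n : ℕ} (A : SpGroup n) :
    (toMatrix n A)ᴴ * formMatrix n * toMatrix n A = formMatrix n := A.2

theorem SpGroup.toMatrix_inv {n : ℕ} (A : SpGroup n) :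
    toMatrix n A⁻¹ = formMatrix n * (toMatrix n A)ᴴ * formMatrix n := by
  have h : toMatrix n A * toMatrix n A⁻¹ = 1 := by rw [← map_mul, mul_inv_cancel, map_one]
  calc toMatrix n A⁻¹ = formMatrix n * (toMatrix n A)ᴴ * formMatrix n * toMatrix n A *
        toMatrix n A⁻¹ := by rw [form_adjoint_mul (toMatrix_form A), Matrix.one_mul]
    _ = _ := by rw [Matrix.mul_assoc _ (toMatrix n A), h, Matrix.mul_one]

/-! ### Quasi-reflections -/

/-- The quaternion `q` as a `1 × 1` matrix. -/
def scalarMatrix (q : ℍ[ℝ]) : Matrix (Fin 1) (Fin 1) ℍ[ℝ] := Matrix.of fun _ _ => q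

/-- The value of the form at a column vector, a real number. -/
def formNorm {n : ℕ} (V : Matrix (Fin (n + 1)) (Fin 1) ℍ[ℝ]) : ℝ :=
  ((Vᴴ * formMatrix n * V) 0 0).re

/-- The quasi-reflection `z ↦ z - V b ⟨z, V⟩`. -/
def quasiReflection {n : ℕ} (V : Matrix (Fin (n + 1)) (Fin 1) ℍ[ℝ]) (b : ℍ[ℝ]) :
    Matrix (Fin (n + 1)) (Fin (n + 1)) ℍ[ℝ] :=
  1 - V * scalarMatrix b * Vᴴ * formMatrix n

/-- For `u ≠ 0` imaginary, a curve of quaternions through `0` in `{b | b + conj b = s |b|²}`. -/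
def reflectionCoeff (s : ℝ) (u : ℍ[ℝ]) (t : ℝ) : ℍ[ℝ] :=
  (t * (t ^ 2 * s ^ 2 / 4 + Quaternion.normSq u)⁻¹) • (((t * s / 2 : ℝ) : ℍ[ℝ]) - u)

theorem scalarMatrix_mul (p q : ℍ[ℝ]) : scalarMatrix p * scalarMatrix q = scalarMatrix (p * q) := by
  ext i j : 1
  simp [scalarMatrix, Matrix.mul_apply]

theorem scalarMatrix_conjTranspose (p : ℍ[ℝ]) : (scalarMatrix p)ᴴ = scalarMatrix (star p) := by
  ext i j : 1
  simp [scalarMatrix, Matrix.conjTranspose_apply]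

theorem scalarMatrix_one : scalarMatrix 1 = 1 := by
  ext i j : 1
  simp [scalarMatrix, Matrix.one_apply, Subsingleton.elim i j]

theorem eq_scalarMatrix (M : Matrix (Fin 1) (Fin 1) ℍ[ℝ]) : M = scalarMatrix (M 0 0) := by
  ext i j : 1
  simp [scalarMatrix, Subsingleton.elim i 0, Subsingleton.elim j 0]

theorem form_self {n : ℕ} (V : Matrix (Fin (n + 1)) (Fin 1) ℍ[ℝ]) :
    Vᴴ * formMatrix n * V = scalarMatrix (formNorm V : ℍ[ℝ]) := by
  have h : (Vᴴ * formMatrix n * V)ᴴ = Vᴴ * formMatrix n * V := by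
    simp [Matrix.conjTranspose_mul, formMatrix_conjTranspose, Matrix.mul_assoc]
  have h0 : star ((Vᴴ * formMatrix n * V) 0 0) = (Vᴴ * formMatrix n * V) 0 0 :=
    congrFun (congrFun h 0) 0
  rw [eq_scalarMatrix (Vᴴ * formMatrix n * V), formNorm, ← Quaternion.star_eq_self.1 h0]

/-- The condition for a quasi-reflection to preserve the form. -/
def IsReflectionCoeff (s : ℝ) (b : ℍ[ℝ]) : Prop := b + star b = ((s * Quaternion.normSq b : ℝ) : ℍ[ℝ])

/-- For b ≠ 0 the condition says Re(b⁻¹) = s/2. Thus `reflectionCoeff s u t` is, for t ≠ 0, the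
inverse of s/2 + u/t. -/
theorem isReflectionCoeff_iff {s : ℝ} {b : ℍ[ℝ]} :
    IsReflectionCoeff s b ↔ 2 * b.re = s * Quaternion.normSq b := by
  have : (2 : ℍ[ℝ]) = ((2 : ℝ) : ℍ[ℝ]) := by norm_cast
  rw [IsReflectionCoeff, Quaternion.self_add_star, this, ← Quaternion.coe_mul, Quaternion.coe_inj]

/-- Expanding leaves H - HV(b + b̄ - b̄sb)V*H with s = ⟨V, V⟩ real, hence central; the bracket
vanishes by the condition on b. -/
theorem quasiReflection_form {n : ℕ} {V : Matrix (Fin (n + 1)) (Fin 1) ℍ[ℝ]} {b : ℍ[ℝ]}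
    (hb : IsReflectionCoeff (formNorm V) b) :
    (quasiReflection V b)ᴴ * formMatrix n * quasiReflection V b = formMatrix n := by
  set H := formMatrix n with hH
  have hb' : scalarMatrix b + scalarMatrix (star b) =
      scalarMatrix (star b) * (Vᴴ * H * V) * scalarMatrix b := by
    have : star b * (formNorm V : ℍ[ℝ]) * b = b + star b := by
      rw [hb, ← Quaternion.coe_commutes, mul_assoc, Quaternion.star_mul_self, Quaternion.coe_mul]
    rw [form_self, scalarMatrix_mul, scalarMatrix_mul, this]
    rfl
  have e1 : (quasiReflection V b)ᴴ = 1 - H * V * scalarMatrix (star b) * Vᴴ := by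
    simp [quasiReflection, Matrix.conjTranspose_mul, scalarMatrix_conjTranspose,
      formMatrix_conjTranspose, Matrix.mul_assoc, hH]
  have e2 : H * V * (scalarMatrix b + scalarMatrix (star b)) * (Vᴴ * H) =
      H * V * (scalarMatrix (star b) * (Vᴴ * H * V) * scalarMatrix b) * (Vᴴ * H) := by rw [hb']
  simp only [Matrix.mul_add, Matrix.add_mul, Matrix.mul_assoc] at e2
  rw [e1, quasiReflection, ← hH]
  simp only [Matrix.mul_sub, Matrix.sub_mul, Matrix.one_mul, Matrix.mul_one, Matrix.mul_assoc]
  rw [← e2]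
  abel

theorem isReflectionCoeff_reflectionCoeff {u : ℍ[ℝ]} (hu : star u = -u) (hu0 : u ≠ 0) (s t : ℝ) :
    IsReflectionCoeff s (reflectionCoeff s u t) := by
  have hre : u.re = 0 := Quaternion.star_eq_neg.1 hu
  have hN : 0 < Quaternion.normSq u :=
    lt_of_le_of_ne Quaternion.normSq_nonneg (Ne.symm (Quaternion.normSq_ne_zero.2 hu0))
  rw [isReflectionCoeff_iff]
  have hD : t ^ 2 * s ^ 2 / 4 + Quaternion.normSq u ≠ 0 := by positivity
  have h2 : Quaternion.normSq (((t * s / 2 : ℝ) : ℍ[ℝ]) - u) =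
      t ^ 2 * s ^ 2 / 4 + Quaternion.normSq u := by
    simp only [Quaternion.normSq_def', Quaternion.re_sub, Quaternion.imI_sub, Quaternion.imJ_sub,
      Quaternion.imK_sub, Quaternion.re_coe, Quaternion.imI_coe, Quaternion.imJ_coe,
      Quaternion.imK_coe, hre]
    ring
  rw [reflectionCoeff, Quaternion.normSq_smul, h2]
  simp only [Quaternion.re_smul, Quaternion.re_sub, Quaternion.re_coe, hre, smul_eq_mul]
  field_simp
  ring

/-- The monoid generated by the quasi-reflections that lie on the standard curves. -/
def reflectionMonoid (n : ℕ) : Submonoid (Matrix (Fin (n + 1)) (Fin (n + 1)) ℍ[ℝ]) :=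
  Submonoid.closure {A | ∃ V u t, star u = -u ∧ u ≠ 0 ∧
    quasiReflection V (reflectionCoeff (formNorm V) u t) = A}

theorem form_of_mem_reflectionMonoid {n : ℕ} {A : Matrix (Fin (n + 1)) (Fin (n + 1)) ℍ[ℝ]}
    (hA : A ∈ reflectionMonoid n) : Aᴴ * formMatrix n * A = formMatrix n := by
  induction hA using Submonoid.closure_induction with
  | mem x hx =>
    obtain ⟨V, u, t, hu, hu0, rfl⟩ := hx
    exact quasiReflection_form (isReflectionCoeff_reflectionCoeff hu hu0 _ _)
  | one => simp
  | mul A B _ _ hA hB =>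
    rw [Matrix.conjTranspose_mul]
    calc Bᴴ * Aᴴ * formMatrix n * (A * B) = Bᴴ * (Aᴴ * formMatrix n * A) * B := by
          simp only [Matrix.mul_assoc]
      _ = formMatrix n := by rw [hA, hB]

theorem quasiReflection_mul {n : ℕ} (V : Matrix (Fin (n + 1)) (Fin 1) ℍ[ℝ]) (b : ℍ[ℝ]) :
    quasiReflection V b * quasiReflection V b =
      quasiReflection V (2 * b - b * (formNorm V : ℍ[ℝ]) * b) := by
  have h : scalarMatrix (2 * b - b * (formNorm V : ℍ[ℝ]) * b) =
      scalarMatrix b + scalarMatrix b - scalarMatrix b * (Vᴴ * formMatrix n * V) *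
        scalarMatrix b := by
    rw [form_self, scalarMatrix_mul, scalarMatrix_mul, two_mul]
    rfl
  rw [quasiReflection, quasiReflection, h]
  simp only [Matrix.mul_sub, Matrix.sub_mul, Matrix.mul_add, Matrix.add_mul, Matrix.one_mul,
    Matrix.mul_one, Matrix.mul_assoc]
  abel

theorem quasiReflection_mem_of_im_ne_zero {n : ℕ} {V : Matrix (Fin (n + 1)) (Fin 1) ℍ[ℝ]}
    {b : ℍ[ℝ]} (hb : IsReflectionCoeff (formNorm V) b) (him : b.im ≠ 0) :
    quasiReflection V b ∈ reflectionMonoid n := by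
  have hb0 : b ≠ 0 := by rintro rfl; simp at him
  have hN : Quaternion.normSq b ≠ 0 := Quaternion.normSq_ne_zero.2 hb0
  rw [isReflectionCoeff_iff] at hb
  -- This u is Im(b⁻¹); at time 1 the curve passes through (s/2 + u)⁻¹ = b.
  refine Submonoid.subset_closure ⟨V, -(Quaternion.normSq b)⁻¹ • b.im, 1, ?_, ?_, ?_⟩
  · rw [Quaternion.star_eq_neg]; simp
  · simp [hN, him]
  · congr 1
    set s := formNorm V
    have hs : s = 2 * b.re / Quaternion.normSq b := by field_simp; linarith
    have hD : (1 : ℝ) ^ 2 * s ^ 2 / 4 + Quaternion.normSq (-(Quaternion.normSq b)⁻¹ • b.im) =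
        (Quaternion.normSq b)⁻¹ := by
      have h3 : Quaternion.normSq b = b.re ^ 2 + Quaternion.normSq b.im := by
        simp [Quaternion.normSq_def']; ring
      rw [Quaternion.normSq_smul, hs]
      field_simp
      linarith
    have hs2 : 1 * s / 2 = b.re * (Quaternion.normSq b)⁻¹ := by rw [hs]; field_simp
    rw [reflectionCoeff, hD, hs2]
    ext <;> simp only [Quaternion.re_smul, Quaternion.re_sub, Quaternion.re_coe, Quaternion.re_im,
      Quaternion.imI_smul, Quaternion.imI_sub, Quaternion.imI_coe, Quaternion.imI_im,
      Quaternion.imJ_smul, Quaternion.imJ_sub, Quaternion.imJ_coe, Quaternion.imJ_im,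
      Quaternion.imK_smul, Quaternion.imK_sub, Quaternion.imK_coe, Quaternion.imK_im,
      smul_eq_mul] <;> field_simp <;> ring

theorem quasiReflection_mem {n : ℕ} {V : Matrix (Fin (n + 1)) (Fin 1) ℍ[ℝ]} {b : ℍ[ℝ]}
    (hb : IsReflectionCoeff (formNorm V) b) : quasiReflection V b ∈ reflectionMonoid n := by
  by_cases him : b.im = 0
  swap
  · exact quasiReflection_mem_of_im_ne_zero hb him
  have hbre : b = (b.re : ℍ[ℝ]) := by
    conv_lhs => rw [← Quaternion.re_add_im b, him, add_zero]
  by_cases hre : b.re = 0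
  · rw [hbre, hre]
    have : scalarMatrix ((0 : ℝ) : ℍ[ℝ]) = 0 := by ext i j : 1; simp [scalarMatrix]
    rw [quasiReflection, this]
    simp
  · rw [isReflectionCoeff_iff, hbre, Quaternion.normSq_coe] at hb
    set r := b.re
    set s := formNorm V
    have hsr : s * r = 2 := by
      have : r * (s * r) = r * 2 := by simp only [Quaternion.re_coe] at hb; linarith
      exact mul_left_cancel₀ hre this
    -- A nonzero real b = 2/s is only the limit of the curves as t → ∞. The reflection, V ↦ -V, is
    -- instead the square of V ↦ Vi, whose coefficient c satisfies 1 - cs = i.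
    obtain ⟨c, c1, c2, c3, c4⟩ : ∃ c : ℍ[ℝ], c.re = r / 2 ∧ c.imI = -r / 2 ∧ c.imJ = 0 ∧
        c.imK = 0 := ⟨⟨r / 2, -r / 2, 0, 0⟩, rfl, rfl, rfl, rfl⟩
    have hc : IsReflectionCoeff s c := by
      rw [isReflectionCoeff_iff]
      simp only [Quaternion.normSq_def', c1, c2, c3, c4]
      linear_combination (-r / 2) * hsr
    have hcm := quasiReflection_mem_of_im_ne_zero (V := V) hc (by
      intro h
      have := congrArg (fun q : ℍ[ℝ] => q.imI) h
      simp [c2, hre] at this)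
    have := Submonoid.mul_mem _ hcm hcm
    rw [quasiReflection_mul] at this
    convert this using 2
    rw [hbre]
    ext <;> simp only [two_mul, Quaternion.re_sub, Quaternion.re_add, Quaternion.re_mul,
      Quaternion.re_coe, Quaternion.imI_sub, Quaternion.imI_add, Quaternion.imI_mul,
      Quaternion.imI_coe, Quaternion.imJ_sub, Quaternion.imJ_add, Quaternion.imJ_mul,
      Quaternion.imJ_coe, Quaternion.imK_sub, Quaternion.imK_add, Quaternion.imK_mul,
      Quaternion.imK_coe, c1, c2, c3, c4]
    · ring
    · have hsr' : formNorm V * r = 2 := hsr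
      linear_combination (-r / 2) * hsr'
    · ring
    · ring

theorem quasiReflection_mul_apply {n : ℕ} (V z : Matrix (Fin (n + 1)) (Fin 1) ℍ[ℝ]) (b : ℍ[ℝ]) :
    quasiReflection V b * z = z - V * scalarMatrix b * (Vᴴ * formMatrix n * z) := by
  simp only [quasiReflection, Matrix.sub_mul, Matrix.one_mul, Matrix.mul_assoc]

/-- Take V = x - y and b = ⟨x, V⟩⁻¹, so that x ↦ x - V = y. Equal lengths give 2 Re⟨x, V⟩ = ⟨V, V⟩,
which is the condition on b. -/
theorem exists_reflection_of_ne_zero {n : ℕ} {x y : Matrix (Fin (n + 1)) (Fin 1) ℍ[ℝ]}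
    (hxy : xᴴ * formMatrix n * x = yᴴ * formMatrix n * y)
    (h0 : (x - y)ᴴ * formMatrix n * x ≠ 0) :
    ∃ A ∈ reflectionMonoid n, A * x = y ∧
      ∀ z : Matrix (Fin (n + 1)) (Fin 1) ℍ[ℝ], xᴴ * formMatrix n * z = 0 →
        yᴴ * formMatrix n * z = 0 → A * z = z := by
  set a : ℍ[ℝ] := ((x - y)ᴴ * formMatrix n * x) 0 0 with ha
  have ha' : (x - y)ᴴ * formMatrix n * x = scalarMatrix a := eq_scalarMatrix _
  have ha0 : a ≠ 0 := by
    intro h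
    apply h0
    rw [ha', h]
    ext i j : 1
    simp [scalarMatrix]
  have hs : scalarMatrix a + scalarMatrix (star a) = scalarMatrix (formNorm (x - y) : ℍ[ℝ]) := by
    rw [← form_self, ← scalarMatrix_conjTranspose, ← ha']
    simp only [Matrix.conjTranspose_mul, Matrix.conjTranspose_sub, formMatrix_conjTranspose,
      Matrix.conjTranspose_conjTranspose, Matrix.mul_sub, Matrix.sub_mul, ← Matrix.mul_assoc, hxy]
    abel
  have hs' : a + star a = (formNorm (x - y) : ℍ[ℝ]) := congrFun (congrFun hs 0) 0
  have hs2 : 2 * a.re = formNorm (x - y) := by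
    have := congrArg (fun q : ℍ[ℝ] => q.re) hs'
    simpa [two_mul] using this
  have hN : Quaternion.normSq a ≠ 0 := Quaternion.normSq_ne_zero.2 ha0
  refine ⟨quasiReflection (x - y) a⁻¹, quasiReflection_mem ?_, ?_, ?_⟩
  · rw [isReflectionCoeff_iff, Quaternion.inv_def, Quaternion.normSq_smul, Quaternion.normSq_star,
      ← hs2]
    simp
    field_simp
  · rw [quasiReflection_mul_apply, ha', Matrix.mul_assoc, scalarMatrix_mul, inv_mul_cancel₀ ha0,
      scalarMatrix_one, Matrix.mul_one, sub_sub_cancel]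
  · intro z hx hy
    have : (x - y)ᴴ * formMatrix n * z = 0 := by
      rw [Matrix.conjTranspose_sub, Matrix.sub_mul, Matrix.sub_mul, hx, hy, sub_zero]
    rw [quasiReflection_mul_apply, this, Matrix.mul_zero, sub_zero]

/-- The monoid acts transitively on the vectors of a given nonzero length, by elements that fix
everything orthogonal to the two vectors. -/
theorem exists_reflectionMonoid_mul_eq {n : ℕ} {x y : Matrix (Fin (n + 1)) (Fin 1) ℍ[ℝ]}
    (hxy : xᴴ * formMatrix n * x = yᴴ * formMatrix n * y) (hx : formNorm x ≠ 0) :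
    ∃ A ∈ reflectionMonoid n, A * x = y ∧
      ∀ z : Matrix (Fin (n + 1)) (Fin 1) ℍ[ℝ], xᴴ * formMatrix n * z = 0 →
        yᴴ * formMatrix n * z = 0 → A * z = z := by
  by_cases h0 : (x - y)ᴴ * formMatrix n * x = 0
  swap
  · exact exists_reflection_of_ne_zero hxy h0
  have hxx : xᴴ * formMatrix n * x ≠ 0 := by
    intro h
    apply hx
    simp [formNorm, h]
  -- When ⟨x, x - y⟩ = 0, go through -x: then ⟨-x, -x - y⟩ = 2⟨x, x⟩ ≠ 0, and x ↦ -x is the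
  -- quasi-reflection in x with coefficient 2/⟨x, x⟩.
  obtain ⟨B, hB, hBx, hBz⟩ := exists_reflection_of_ne_zero (x := -x) (y := y)
    (by simpa using hxy) (by
      have h1 : yᴴ * formMatrix n * x = xᴴ * formMatrix n * x := by
        rw [Matrix.conjTranspose_sub, Matrix.sub_mul, Matrix.sub_mul, sub_eq_zero] at h0
        exact h0.symm
      have : (-x - y)ᴴ * formMatrix n * (-x) = (2 : ℝ) • (xᴴ * formMatrix n * x) := by
        simp only [Matrix.conjTranspose_sub, Matrix.conjTranspose_neg, Matrix.sub_mul,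
          Matrix.neg_mul, Matrix.mul_neg, h1, two_smul]
        abel
      rw [this]
      exact smul_ne_zero two_ne_zero hxx)
  have hc : IsReflectionCoeff (formNorm x) ((2 / formNorm x : ℝ) : ℍ[ℝ]) := by
    rw [isReflectionCoeff_iff, Quaternion.normSq_coe, Quaternion.re_coe]
    field_simp
  refine ⟨B * quasiReflection x _, Submonoid.mul_mem _ hB (quasiReflection_mem hc), ?_, ?_⟩
  · rw [Matrix.mul_assoc, quasiReflection_mul_apply, form_self, Matrix.mul_assoc, scalarMatrix_mul,
      ← Quaternion.coe_mul, div_mul_cancel₀ _ hx]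
    have : x - x * scalarMatrix ((2 : ℝ) : ℍ[ℝ]) = -x := by
      have : scalarMatrix ((2 : ℝ) : ℍ[ℝ]) = 1 + 1 := by
        rw [← scalarMatrix_one]
        ext i j : 1
        simp only [scalarMatrix, Matrix.of_apply, Matrix.add_apply]
        rw [one_add_one_eq_two]
        norm_cast
      rw [this, Matrix.mul_add, Matrix.mul_one]
      abel
    rw [this, hBx]
  · intro z h1 h2
    rw [Matrix.mul_assoc, quasiReflection_mul_apply, h1, Matrix.mul_zero, sub_zero]
    exact hBz z (by simpa using h1) h2

end

/-! ### Quasi-reflections generate Sp(n,1) -/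

noncomputable section

/-- The standard basis as column vectors. -/
def unitVector (n : ℕ) (k : Fin (n + 1)) : Matrix (Fin (n + 1)) (Fin 1) ℍ[ℝ] :=
  Matrix.of fun j _ => if j = k then 1 else 0

theorem form_unitVector {n : ℕ} (k l : Fin (n + 1)) :
    (unitVector n k)ᴴ * formMatrix n * unitVector n l =
      if Equiv.swap 0 (Fin.last n) k = l then 1 else 0 := by
  have h : (unitVector n k)ᴴ * formMatrix n * unitVector n l = scalarMatrix
      (if Equiv.swap 0 (Fin.last n) k = l then 1 else 0) := by
    rw [eq_scalarMatrix ((unitVector n k)ᴴ * formMatrix n * unitVector n l), Matrix.mul_assoc,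
      Matrix.mul_apply]
    congr 1
    rw [Finset.sum_eq_single k (fun x _ hx => by
      simp [Matrix.conjTranspose_apply, unitVector, hx]) (by simp), formMatrix_mul_apply]
    simp [Matrix.conjTranspose_apply, unitVector]
  rw [h]
  split_ifs
  · exact scalarMatrix_one
  · ext i j : 1
    simp [scalarMatrix]

/-- An orthogonal basis of anisotropic vectors for the form. -/
def orthoVector (n : ℕ) (i : Fin (n + 1)) : Matrix (Fin (n + 1)) (Fin 1) ℍ[ℝ] :=
  if i = 0 then unitVector n 0 + unitVector n (Fin.last n)
  else if i = Fin.last n then unitVector n 0 - unitVector n (Fin.last n) else unitVector n i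

theorem zero_ne_last {n : ℕ} (hn : 1 ≤ n) : (0 : Fin (n + 1)) ≠ Fin.last n := by
  intro h
  have := congrArg Fin.val h
  simp at this
  omega

theorem form_orthoVector {n : ℕ} (hn : 1 ≤ n) {i j : Fin (n + 1)} (hij : i ≠ j) :
    (orthoVector n i)ᴴ * formMatrix n * orthoVector n j = 0 := by
  have h := zero_ne_last hn
  unfold orthoVector
  split_ifs <;> simp_all [Matrix.add_mul, Matrix.mul_add, Matrix.sub_mul, Matrix.mul_sub,
    form_unitVector, Equiv.swap_apply_of_ne_of_ne, eq_comm]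

theorem formNorm_orthoVector {n : ℕ} (hn : 1 ≤ n) (i : Fin (n + 1)) :
    formNorm (orthoVector n i) ≠ 0 := by
  have h := zero_ne_last hn
  unfold orthoVector formNorm
  split_ifs <;> simp_all [Matrix.add_mul, Matrix.mul_add, Matrix.sub_mul, Matrix.mul_sub,
    form_unitVector, Equiv.swap_apply_of_ne_of_ne]
  norm_num

theorem eq_one_of_mul_orthoVector {n : ℕ} (hn : 1 ≤ n)
    {A : Matrix (Fin (n + 1)) (Fin (n + 1)) ℍ[ℝ]}
    (h : ∀ i, A * orthoVector n i = orthoVector n i) : A = 1 := by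
  have hl := (zero_ne_last hn).symm
  have h0 := h 0
  have h1 := h (Fin.last n)
  simp only [orthoVector, if_true, hl, if_false, Matrix.mul_add, Matrix.mul_sub] at h0 h1
  have e0 : A * unitVector n 0 = unitVector n 0 := by
    have : (2 : ℝ) • (A * unitVector n 0) = (2 : ℝ) • unitVector n 0 := by
      have := congrArg₂ (· + ·) h0 h1
      simp only [add_add_sub_cancel] at this
      simpa only [two_smul] using this
    exact smul_right_injective _ (two_ne_zero (α := ℝ)) this
  have e1 : A * unitVector n (Fin.last n) = unitVector n (Fin.last n) := by
    rwa [e0, add_right_inj] at h0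
  have hk : ∀ k, A * unitVector n k = unitVector n k := by
    intro k
    by_cases k0 : k = 0
    · rw [k0, e0]
    by_cases k1 : k = Fin.last n
    · rw [k1, e1]
    simpa [orthoVector, k0, k1] using h k
  ext i k : 1
  have := congrFun (congrFun (hk k) i) 0
  rw [Matrix.mul_apply] at this
  simpa [unitVector, Matrix.one_apply] using this

/-- Cartan–Dieudonné: if A fixes the first k vectors of an anisotropic orthogonal basis, choose B in
the monoid that fixes them and agrees with A on the next one; B⁻¹A then fixes k + 1 of them. -/
theorem mem_reflectionMonoid {n : ℕ} (hn : 1 ≤ n) {A : Matrix (Fin (n + 1)) (Fin (n + 1)) ℍ[ℝ]}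
    (hA : Aᴴ * formMatrix n * A = formMatrix n) : A ∈ reflectionMonoid n := by
  suffices H : ∀ d k : ℕ, k + d = n + 1 → ∀ A : Matrix (Fin (n + 1)) (Fin (n + 1)) ℍ[ℝ],
      Aᴴ * formMatrix n * A = formMatrix n →
      (∀ i : Fin (n + 1), i.1 < k → A * orthoVector n i = orthoVector n i) →
      A ∈ reflectionMonoid n from
    H (n + 1) 0 (by omega) A hA fun i hi => absurd hi (Nat.not_lt_zero _)
  intro d
  induction d with
  | zero =>
    intro k hk A _ h
    rw [eq_one_of_mul_orthoVector hn fun i => h i (by omega)]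
    exact Submonoid.one_mem _
  | succ d ih =>
    intro k hk A hA h
    have key : ∀ V W : Matrix (Fin (n + 1)) (Fin 1) ℍ[ℝ],
        (A * V)ᴴ * formMatrix n * (A * W) = Vᴴ * formMatrix n * W := by
      intro V W
      rw [Matrix.conjTranspose_mul]
      calc Vᴴ * Aᴴ * formMatrix n * (A * W) = Vᴴ * (Aᴴ * formMatrix n * A) * W := by
            simp only [Matrix.mul_assoc]
        _ = _ := by rw [hA]
    let j : Fin (n + 1) := ⟨k, by omega⟩
    obtain ⟨B, hB, hBx, hBz⟩ := exists_reflectionMonoid_mul_eq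
      (key (orthoVector n j) (orthoVector n j)).symm (formNorm_orthoVector hn j)
    have hBf := form_of_mem_reflectionMonoid hB
    set B' := formMatrix n * Bᴴ * formMatrix n with hB'
    have hBB : B * B' = 1 := mul_form_adjoint hBf
    have hBB' : B' * B = 1 := form_adjoint_mul hBf
    -- An earlier basis vector is orthogonal to the k-th one and, since A fixes the former and
    -- preserves the form, also to the image of the latter.
    have hBfix : ∀ i : Fin (n + 1), i.1 < k → B * orthoVector n i = orthoVector n i := by
      intro i hi
      have hji : j ≠ i := by
        rintro rfl
        exact lt_irrefl _ hi
      refine hBz _ (form_orthoVector hn hji) ?_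
      have := key (orthoVector n j) (orthoVector n i)
      rwa [h i hi, form_orthoVector hn hji] at this
    have hABA : A = B * (B' * A) := by rw [← Matrix.mul_assoc, hBB, Matrix.one_mul]
    rw [hABA]
    refine Submonoid.mul_mem _ hB (ih (k + 1) (by omega) _ ?_ ?_)
    · calc (B' * A)ᴴ * formMatrix n * (B' * A)
          = (B' * A)ᴴ * (Bᴴ * formMatrix n * B) * (B' * A) := by rw [hBf]
        _ = (B * (B' * A))ᴴ * formMatrix n * (B * (B' * A)) := by
          rw [Matrix.conjTranspose_mul B]; simp only [Matrix.mul_assoc]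
        _ = formMatrix n := by rw [← hABA, hA]
    · intro i hi
      rw [Matrix.mul_assoc]
      by_cases hik : i.1 < k
      · rw [h i hik]
        nth_rw 1 [← hBfix i hik]
        rw [← Matrix.mul_assoc, hBB', Matrix.one_mul]
      · obtain rfl : i = j := Fin.ext (by change i.1 = k; omega)
        rw [← hBx, ← Matrix.mul_assoc, hBB', Matrix.one_mul]

/-! ### The real trace and the reversal polynomial -/

theorem Quaternion.re_finset_sum {ι : Type*} (s : Finset ι) (f : ι → ℍ[ℝ]) :
    (∑ i ∈ s, f i).re = ∑ i ∈ s, (f i).re := by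
  classical
  induction s using Finset.induction_on with
  | empty => simp
  | insert a s ha ih => rw [Finset.sum_insert ha, Finset.sum_insert ha, Quaternion.re_add, ih]

/-- The real part of the trace. -/
def reTrace {m : Type*} [Fintype m] (A : Matrix m m ℍ[ℝ]) : ℝ := ∑ i, (A i i).re

/-- The quaternionic trace itself is not cyclic, but Re(pq) = Re(qp). -/
theorem reTrace_mul_comm {m p : Type*} [Fintype m] [Fintype p] (A : Matrix m p ℍ[ℝ])
    (B : Matrix p m ℍ[ℝ]) : reTrace (A * B) = reTrace (B * A) := by
  simp only [reTrace, Matrix.mul_apply, Quaternion.re_finset_sum]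
  rw [Finset.sum_comm]
  refine Finset.sum_congr rfl fun i _ => Finset.sum_congr rfl fun j _ => ?_
  simp only [Quaternion.re_mul]
  ring

theorem reTrace_conjTranspose {m : Type*} [Fintype m] (A : Matrix m m ℍ[ℝ]) :
    reTrace Aᴴ = reTrace A := by
  simp [reTrace, Matrix.conjTranspose_apply]

theorem reTrace_neg {m : Type*} [Fintype m] (A : Matrix m m ℍ[ℝ]) :
    reTrace (-A) = -reTrace A := by
  simp [reTrace]

theorem reTrace_add {m : Type*} [Fintype m] (A B : Matrix m m ℍ[ℝ]) :
    reTrace (A + B) = reTrace A + reTrace B := by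
  simp [reTrace, Finset.sum_add_distrib]

theorem reTrace_one {m : Type*} [Fintype m] [DecidableEq m] :
    reTrace (1 : Matrix m m ℍ[ℝ]) = Fintype.card m := by
  simp [reTrace]

/-- A polynomial in two matrices which vanishes if they are simultaneously conjugate to
`±` their inverses in `Sp(n,1)`. -/
def reversalPoly {m : Type*} [Fintype m] (A B : Matrix m m ℍ[ℝ]) : ℝ :=
  reTrace (A * B * A * A * B * B) ^ 2 - reTrace (B * B * A * A * B * A) ^ 2

theorem reTrace_inv {n : ℕ} (A : SpGroup n) :
    reTrace (SpGroup.toMatrix n A⁻¹) = reTrace (SpGroup.toMatrix n A) := by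
  rw [SpGroup.toMatrix_inv, reTrace_mul_comm, ← Matrix.mul_assoc, formMatrix_mul_self,
    Matrix.one_mul, reTrace_conjTranspose]

theorem reTrace_conj {n : ℕ} (h A : SpGroup n) :
    reTrace (SpGroup.toMatrix n (h * A * h⁻¹)) = reTrace (SpGroup.toMatrix n A) := by
  rw [map_mul, reTrace_mul_comm, ← map_mul, inv_mul_cancel_left]

theorem reversalPoly_conj {n : ℕ} (h A B : SpGroup n) :
    reversalPoly (SpGroup.toMatrix n (h * A * h⁻¹)) (SpGroup.toMatrix n (h * B * h⁻¹)) =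
      reversalPoly (SpGroup.toMatrix n A) (SpGroup.toMatrix n B) := by
  simp only [reversalPoly, ← map_mul]
  rw [← reTrace_conj h (A * B * A * A * B * B), ← reTrace_conj h (B * B * A * A * B * A)]
  congr 4 <;> group

/-- The inverse of each word in A, B is the other word in A⁻¹, B⁻¹, so inversion swaps the two
squares. -/
theorem reversalPoly_inv {n : ℕ} (A B : SpGroup n) :
    reversalPoly (SpGroup.toMatrix n A⁻¹) (SpGroup.toMatrix n B⁻¹) =
      -reversalPoly (SpGroup.toMatrix n A) (SpGroup.toMatrix n B) := by
  simp only [reversalPoly, ← map_mul]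
  rw [← reTrace_inv (A * B * A * A * B * B), ← reTrace_inv (B * B * A * A * B * A), neg_sub]
  congr 4 <;> group

theorem reversalPoly_neg_left {m : Type*} [Fintype m] (A B : Matrix m m ℍ[ℝ]) :
    reversalPoly (-A) B = reversalPoly A B := by
  simp [reversalPoly, reTrace_neg]

theorem reversalPoly_neg_right {m : Type*} [Fintype m] (A B : Matrix m m ℍ[ℝ]) :
    reversalPoly A (-B) = reversalPoly A B := by
  simp [reversalPoly, reTrace_neg]

/-! ### A pair with nonzero reversal polynomial, from Sp(1,1) -/

/-- The coordinate vectors of the hyperbolic plane. -/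
def planeInclusion (n : ℕ) : Matrix (Fin (n + 1)) (Fin 2) ℍ[ℝ] :=
  Matrix.of fun i j => if i = ![0, Fin.last n] j then 1 else 0

/-- The extension of a matrix on the hyperbolic plane by the identity. -/
def planeExtension (n : ℕ) (X : Matrix (Fin 2) (Fin 2) ℍ[ℝ]) :
    Matrix (Fin (n + 1)) (Fin (n + 1)) ℍ[ℝ] :=
  1 + planeInclusion n * (X - 1) * (planeInclusion n)ᴴ

theorem planeInclusion_isometry {n : ℕ} (hn : 1 ≤ n) :
    (planeInclusion n)ᴴ * planeInclusion n = 1 := by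
  have h := zero_ne_last hn
  ext i j : 1
  rw [Matrix.mul_apply]
  rw [Finset.sum_eq_single (![0, Fin.last n] i) (fun x _ hx => by
    simp [Matrix.conjTranspose_apply, planeInclusion, hx]) (by simp)]
  fin_cases i <;> fin_cases j <;>
    simp [planeInclusion, Matrix.conjTranspose_apply, h, h.symm]

theorem formMatrix_mul_planeInclusion (n : ℕ) :
    formMatrix n * planeInclusion n = planeInclusion n * formMatrix 1 := by
  ext i j : 1
  rw [formMatrix_mul_apply, Matrix.mul_apply]
  fin_cases j <;>
    simp [planeInclusion, formMatrix, Fin.sum_univ_two, Equiv.swap_apply_eq_iff, Fin.last]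
  rfl

theorem planeExtension_mul {n : ℕ} (hn : 1 ≤ n) (X Y : Matrix (Fin 2) (Fin 2) ℍ[ℝ]) :
    planeExtension n X * planeExtension n Y = planeExtension n (X * Y) := by
  have h : planeInclusion n * (X - 1) * (planeInclusion n)ᴴ *
      (planeInclusion n * (Y - 1) * (planeInclusion n)ᴴ) =
      planeInclusion n * ((X - 1) * (Y - 1)) * (planeInclusion n)ᴴ := by
    calc _ = planeInclusion n * (X - 1) * ((planeInclusion n)ᴴ * planeInclusion n) * (Y - 1) *
        (planeInclusion n)ᴴ := by simp only [Matrix.mul_assoc]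
      _ = _ := by rw [planeInclusion_isometry hn, Matrix.mul_one]; simp only [Matrix.mul_assoc]
  have h2 : X * Y - 1 = (X - 1) + (Y - 1) + (X - 1) * (Y - 1) := by noncomm_ring
  rw [planeExtension, planeExtension, planeExtension, add_mul, mul_add, mul_add, h, h2]
  simp only [Matrix.mul_add, Matrix.add_mul, Matrix.one_mul, Matrix.mul_one]
  abel

theorem planeExtension_conjTranspose (n : ℕ) (X : Matrix (Fin 2) (Fin 2) ℍ[ℝ]) :
    (planeExtension n X)ᴴ = planeExtension n Xᴴ := by
  simp [planeExtension, Matrix.conjTranspose_mul, Matrix.mul_assoc]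

theorem reTrace_planeExtension {n : ℕ} (hn : 1 ≤ n) (X : Matrix (Fin 2) (Fin 2) ℍ[ℝ]) :
    reTrace (planeExtension n X) = reTrace X + (n - 1) := by
  rw [planeExtension, reTrace_add, reTrace_mul_comm, ← Matrix.mul_assoc,
    planeInclusion_isometry hn, Matrix.one_mul, sub_eq_add_neg, reTrace_add, reTrace_neg,
    reTrace_one, reTrace_one]
  simp
  ring

theorem planeExtension_form {n : ℕ} (hn : 1 ≤ n) {X : Matrix (Fin 2) (Fin 2) ℍ[ℝ]}
    (hX : Xᴴ * formMatrix 1 * X = formMatrix 1) :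
    (planeExtension n X)ᴴ * formMatrix n * planeExtension n X = formMatrix n := by
  have h1 : (planeInclusion n)ᴴ * formMatrix n = formMatrix 1 * (planeInclusion n)ᴴ := by
    have := congrArg Matrix.conjTranspose (formMatrix_mul_planeInclusion n)
    simpa [Matrix.conjTranspose_mul, formMatrix_conjTranspose] using this
  have h2 : planeExtension n Xᴴ * formMatrix n =
      formMatrix n * planeExtension n (formMatrix 1 * Xᴴ * formMatrix 1) := by
    have h3 : formMatrix 1 * Xᴴ * formMatrix 1 - 1 = formMatrix 1 * (Xᴴ - 1) * formMatrix 1 := by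
      rw [Matrix.mul_sub, Matrix.sub_mul, Matrix.mul_one, formMatrix_mul_self]
    have h4 : planeInclusion n * formMatrix 1 * formMatrix 1 = planeInclusion n := by
      rw [Matrix.mul_assoc, formMatrix_mul_self, Matrix.mul_one]
    rw [planeExtension, planeExtension, h3, Matrix.add_mul, Matrix.mul_add, Matrix.mul_one,
      Matrix.one_mul, Matrix.mul_assoc, h1]
    congr 1
    simp only [← Matrix.mul_assoc]
    rw [formMatrix_mul_planeInclusion, h4]
  have h5 : formMatrix 1 * Xᴴ * formMatrix 1 * X = 1 := form_adjoint_mul hX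
  rw [planeExtension_conjTranspose, h2, Matrix.mul_assoc, planeExtension_mul hn, h5]
  simp [planeExtension]

theorem exists_reversalPoly_ne_zero {n : ℕ} (hn : 1 ≤ n) :
    ∃ A B : SpGroup n, reversalPoly (SpGroup.toMatrix n A) (SpGroup.toMatrix n B) ≠ 0 := by
  obtain ⟨qi, i1, i2, i3, i4⟩ : ∃ q : ℍ[ℝ], q.re = 0 ∧ q.imI = 1 ∧ q.imJ = 0 ∧ q.imK = 0 :=
    ⟨⟨0, 1, 0, 0⟩, rfl, rfl, rfl, rfl⟩
  obtain ⟨qk, k1, k2, k3, k4⟩ : ∃ q : ℍ[ℝ], q.re = 0 ∧ q.imI = 0 ∧ q.imJ = 0 ∧ q.imK = 1 :=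
    ⟨⟨0, 0, 0, 1⟩, rfl, rfl, rfl, rfl⟩
  have hi : qi * qi = -1 := by ext <;> simp [i1, i2, i3, i4]
  have hk : qk * qk = -1 := by ext <;> simp [k1, k2, k3, k4]
  have hik : qk * qi = -(qi * qk) := by ext <;> simp [i1, i2, i3, i4, k1, k2, k3, k4]
  have hsi : star qi = -qi := Quaternion.star_eq_neg.2 i1
  have hsk : star qk = -qk := Quaternion.star_eq_neg.2 k1
  have hform : formMatrix 1 = !![0, 1; 1, 0] := by
    ext i j : 1
    fin_cases i <;> fin_cases j <;> simp [formMatrix, Fin.last]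
  let a : Matrix (Fin 2) (Fin 2) ℍ[ℝ] := !![qk, 1; 1, 0]
  let b : Matrix (Fin 2) (Fin 2) ℍ[ℝ] := !![qi, 0; -1, qi]
  have ha : aᴴ * formMatrix 1 * a = formMatrix 1 := by
    rw [hform]
    ext i j : 1
    fin_cases i <;> fin_cases j <;> simp [a, Matrix.mul_apply, Fin.sum_univ_two, hsk]
  have hb : bᴴ * formMatrix 1 * b = formMatrix 1 := by
    rw [hform]
    ext i j : 1
    fin_cases i <;> fin_cases j <;> simp [b, Matrix.mul_apply, Fin.sum_univ_two, hsi, hi]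
  have t1 : reTrace (a * b * a * a * b * b) = 4 := by
    simp [a, b, reTrace, Fin.sum_univ_two, i1, i2, i3, i4, k1, k2, k3, k4]
    norm_num
  have t2 : reTrace (b * b * a * a * b * a) = 0 := by
    simp [a, b, reTrace, Fin.sum_univ_two, i1, i2, i3, i4, k1, k2, k3, k4]
  refine ⟨SpGroup.ofMatrix _ (planeExtension_form hn ha),
    SpGroup.ofMatrix _ (planeExtension_form hn hb), ?_⟩
  change reversalPoly (planeExtension n a) (planeExtension n b) ≠ 0
  -- The identity block adds n - 1 to both traces; the value is (n + 3)² - (n - 1)² = 8(n + 1).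
  simp only [reversalPoly, planeExtension_mul hn, reTrace_planeExtension hn, t1, t2]
  have : (1 : ℝ) ≤ n := by exact_mod_cast hn
  nlinarith

end

/-! ### Topology of PSp(n,1) and descent of the polynomial -/

noncomputable section

instance Quaternion.instProperSpace : ProperSpace ℍ[ℝ] := FiniteDimensional.proper ℝ ℍ[ℝ]

instance (n : ℕ) : SecondCountableTopology (Matrix (Fin n) (Fin n) ℍ[ℝ]) :=
  inferInstanceAs (SecondCountableTopology (Fin n → Fin n → ℍ[ℝ]))

instance (n : ℕ) : LocallyCompactSpace (Matrix (Fin n) (Fin n) ℍ[ℝ]) :=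
  inferInstanceAs (LocallyCompactSpace (Fin n → Fin n → ℍ[ℝ]))

instance (n : ℕ) : SecondCountableTopology (Matrix (Fin n) (Fin n) ℍ[ℝ])ˣ :=
  haveI : SecondCountableTopology (Matrix (Fin n) (Fin n) ℍ[ℝ])ᵐᵒᵖ :=
    MulOpposite.opHomeomorph.symm.isEmbedding.secondCountableTopology
  Units.isEmbedding_embedProduct.secondCountableTopology

theorem SpGroup.isClosed (n : ℕ) :
    IsClosed (SpGroup n : Set (Matrix (Fin (n + 1)) (Fin (n + 1)) ℍ[ℝ])ˣ) := by
  have h : Continuous fun A : (Matrix (Fin (n + 1)) (Fin (n + 1)) ℍ[ℝ])ˣ =>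
      (A.val)ᴴ * formMatrix n * A.val := by
    have := Units.continuous_val (M := Matrix (Fin (n + 1)) (Fin (n + 1)) ℍ[ℝ])
    fun_prop
  exact isClosed_singleton.preimage h

instance (n : ℕ) : LocallyCompactSpace (SpGroup n) := (SpGroup.isClosed n).locallyCompactSpace

instance (n : ℕ) : LocallyCompactSpace (PSpGroup n) :=
  inferInstanceAs (LocallyCompactSpace (SpGroup n ⧸ plusMinusOne n))

instance (n : ℕ) : SecondCountableTopology (PSpGroup n) :=
  haveI : SecondCountableTopology (SpGroup n) :=
    Topology.IsEmbedding.subtypeVal.secondCountableTopology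
  QuotientGroup.isOpenQuotientMap_mk.isQuotientMap.secondCountableTopology
    QuotientGroup.isOpenQuotientMap_mk.isOpenMap

/-- The projection from `Sp(n,1)` to `PSp(n,1)`. -/
def PSpGroup.mk (n : ℕ) : SpGroup n →* PSpGroup n := QuotientGroup.mk' (plusMinusOne n)

theorem PSpGroup.mk_surjective (n : ℕ) : Function.Surjective (mk n) :=
  QuotientGroup.mk'_surjective _

theorem PSpGroup.isOpenQuotientMap_mk (n : ℕ) : IsOpenQuotientMap (mk n) :=
  QuotientGroup.isOpenQuotientMap_mk

theorem PSpGroup.mk_eq_mk {n : ℕ} {A B : SpGroup n} (h : mk n A = mk n B) :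
    SpGroup.toMatrix n A = SpGroup.toMatrix n B ∨
      SpGroup.toMatrix n A = -SpGroup.toMatrix n B := by
  have h1 : B⁻¹ * A ∈ plusMinusOne n := QuotientGroup.eq.1 h.symm
  have h2 : SpGroup.toMatrix n A = SpGroup.toMatrix n B * SpGroup.toMatrix n (B⁻¹ * A) := by
    rw [← map_mul, mul_inv_cancel_left]
  rcases h1 with h1 | h1
  · left
    have : SpGroup.toMatrix n (B⁻¹ * A) = 1 := congrArg Units.val h1
    rw [h2, this, Matrix.mul_one]
  · right
    have : SpGroup.toMatrix n (B⁻¹ * A) = -1 := congrArg Units.val h1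
    rw [h2, this, Matrix.mul_neg, Matrix.mul_one]

/-- The function that `reversalPoly` induces on pairs of elements of `PSp(n,1)`. -/
def reversalFun {n : ℕ} (g g' : PSpGroup n) : ℝ :=
  reversalPoly (SpGroup.toMatrix n (PSpGroup.mk_surjective n g).choose)
    (SpGroup.toMatrix n (PSpGroup.mk_surjective n g').choose)

theorem reversalFun_mk {n : ℕ} (A B : SpGroup n) :
    reversalFun (PSpGroup.mk n A) (PSpGroup.mk n B) =
      reversalPoly (SpGroup.toMatrix n A) (SpGroup.toMatrix n B) := by
  rw [reversalFun]
  rcases PSpGroup.mk_eq_mk (PSpGroup.mk_surjective n (PSpGroup.mk n A)).choose_spec with h | h <;>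
  rcases PSpGroup.mk_eq_mk (PSpGroup.mk_surjective n (PSpGroup.mk n B)).choose_spec with h' | h' <;>
  simp only [h, h', reversalPoly_neg_left, reversalPoly_neg_right]

theorem SpGroup.continuous_toMatrix (n : ℕ) : Continuous (toMatrix n) :=
  Units.continuous_val.comp continuous_subtype_val

theorem continuous_reTrace {m : Type*} [Fintype m] :
    Continuous (reTrace : Matrix m m ℍ[ℝ] → ℝ) :=
  continuous_finsetSum _ fun i _ => Quaternion.continuous_re.comp (continuous_id.matrix_elem i i)

theorem continuous_reversalFun (n : ℕ) :
    Continuous fun p : PSpGroup n × PSpGroup n => reversalFun p.1 p.2 := by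
  -- Openness matters: a product of open quotient maps is again a quotient map, so continuity can be
  -- tested on Sp(n,1)².
  rw [((PSpGroup.isOpenQuotientMap_mk n).prodMap
    (PSpGroup.isOpenQuotientMap_mk n)).isQuotientMap.continuous_iff]
  have h1 := (SpGroup.continuous_toMatrix n).comp (continuous_fst (Y := SpGroup n))
  have h2 := (SpGroup.continuous_toMatrix n).comp (continuous_snd (X := SpGroup n))
  have hc := continuous_reTrace (m := Fin (n + 1))
  have : Continuous fun p : SpGroup n × SpGroup n =>
      reversalPoly (SpGroup.toMatrix n p.1) (SpGroup.toMatrix n p.2) := by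
    simp only [reversalPoly, Function.comp_def] at h1 h2 ⊢
    fun_prop
  refine this.congr fun p => ?_
  exact (reversalFun_mk p.1 p.2).symm

/-- Conjugation preserves the value and inversion negates it, so the value equals its own negative.
-/
theorem reversalFun_eq_zero {n : ℕ} {g g' h : PSpGroup n} (hg : h * g * h⁻¹ = g⁻¹)
    (hg' : h * g' * h⁻¹ = g'⁻¹) : reversalFun g g' = 0 := by
  obtain ⟨A, rfl⟩ := PSpGroup.mk_surjective n g
  obtain ⟨B, rfl⟩ := PSpGroup.mk_surjective n g'
  obtain ⟨C, rfl⟩ := PSpGroup.mk_surjective n h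
  have h1 := reversalFun_mk (C * A * C⁻¹) (C * B * C⁻¹)
  have h2 := reversalFun_mk A⁻¹ B⁻¹
  simp only [map_mul, map_inv] at h1 h2
  rw [hg, hg', h2] at h1
  simp only [← map_mul] at h1
  rw [reversalPoly_inv, reversalPoly_conj] at h1
  rw [reversalFun_mk]
  linarith

/-! ### Analytic curves and the dichotomy -/

/-- The standard curve through `1` in `Sp(n,1)`, for `u ≠ 0` imaginary. -/
def reflectionCurve {n : ℕ} (V : Matrix (Fin (n + 1)) (Fin 1) ℍ[ℝ]) (u : ℍ[ℝ]) (hu : star u = -u)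
    (hu0 : u ≠ 0) (t : ℝ) : SpGroup n :=
  SpGroup.ofMatrix (quasiReflection V (reflectionCoeff (formNorm V) u t))
    (quasiReflection_form (isReflectionCoeff_reflectionCoeff hu hu0 _ t))

theorem SpGroup.toMatrix_ofMatrix {n : ℕ} (A : Matrix (Fin (n + 1)) (Fin (n + 1)) ℍ[ℝ])
    (hA : Aᴴ * formMatrix n * A = formMatrix n) : toMatrix n (ofMatrix A hA) = A := rfl

/-- A curve of matrices with analytic entries. -/
def AnalyticEntries {m p : Type*} (A : ℝ → Matrix m p ℍ[ℝ]) : Prop :=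
  ∀ i j, AnalyticOnNhd ℝ (fun t => A t i j) Set.univ

theorem AnalyticEntries.const {m p : Type*} (A : Matrix m p ℍ[ℝ]) :
    AnalyticEntries fun _ => A := fun _ _ => analyticOnNhd_const

theorem AnalyticEntries.mul {m p r : Type*} [Fintype p] {A : ℝ → Matrix m p ℍ[ℝ]}
    {B : ℝ → Matrix p r ℍ[ℝ]} (hA : AnalyticEntries A) (hB : AnalyticEntries B) :
    AnalyticEntries fun t => A t * B t := by
  intro i j
  simp only [Matrix.mul_apply]
  exact Finset.analyticOnNhd_fun_sum _ fun k _ => (hA i k).mul (hB k j)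

theorem AnalyticEntries.sub {m p : Type*} {A B : ℝ → Matrix m p ℍ[ℝ]} (hA : AnalyticEntries A)
    (hB : AnalyticEntries B) : AnalyticEntries fun t => A t - B t :=
  fun i j => (hA i j).sub (hB i j)

theorem AnalyticEntries.reTrace {m : Type*} [Fintype m] {A : ℝ → Matrix m m ℍ[ℝ]}
    (hA : AnalyticEntries A) : AnalyticOnNhd ℝ (fun t => reTrace (A t)) Set.univ := by
  let L : ℍ[ℝ] →L[ℝ] ℝ := ⟨⟨⟨fun q => q.re, fun _ _ => rfl⟩, fun _ _ => rfl⟩,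
    Quaternion.continuous_re⟩
  exact Finset.analyticOnNhd_fun_sum _ fun i _ => L.comp_analyticOnNhd (hA i i)

theorem AnalyticEntries.reversalPoly {m : Type*} [Fintype m] {A B : ℝ → Matrix m m ℍ[ℝ]}
    (hA : AnalyticEntries A) (hB : AnalyticEntries B) :
    AnalyticOnNhd ℝ (fun t => reversalPoly (A t) (B t)) Set.univ :=
  (((((((hA.mul hB).mul hA).mul hA).mul hB).mul hB).reTrace).pow 2).sub
    (((((((hB.mul hB).mul hA).mul hA).mul hB).mul hA).reTrace).pow 2)

theorem analyticOnNhd_reflectionCoeff (s : ℝ) {u : ℍ[ℝ]} (hu0 : u ≠ 0) :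
    AnalyticOnNhd ℝ (reflectionCoeff s u) Set.univ := by
  intro t _
  have hN : 0 < Quaternion.normSq u :=
    lt_of_le_of_ne Quaternion.normSq_nonneg (Ne.symm (Quaternion.normSq_ne_zero.2 hu0))
  have h1 : AnalyticAt ℝ (fun t : ℝ => t * (t ^ 2 * s ^ 2 / 4 + Quaternion.normSq u)⁻¹) t := by
    have : t ^ 2 * s ^ 2 / 4 + Quaternion.normSq u ≠ 0 := by positivity
    fun_prop (disch := assumption)
  have h2 : AnalyticAt ℝ (fun t : ℝ => ((t * s / 2 : ℝ) : ℍ[ℝ]) - u) t := by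
    have : (fun t : ℝ => ((t * s / 2 : ℝ) : ℍ[ℝ]) - u) =
        fun t : ℝ => (t * s / 2) • (1 : ℍ[ℝ]) - u := by
      funext t
      congr 1
      generalize t * s / 2 = r
      ext <;> simp
    rw [this]
    fun_prop
  exact h1.smul h2

theorem analyticEntries_reflectionCurve {n : ℕ} (V : Matrix (Fin (n + 1)) (Fin 1) ℍ[ℝ]) (u : ℍ[ℝ])
    (hu : star u = -u) (hu0 : u ≠ 0) :
    AnalyticEntries fun t => SpGroup.toMatrix n (reflectionCurve V u hu hu0 t) :=
  (AnalyticEntries.const 1).sub ((((AnalyticEntries.const V).mul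
    fun _ _ => analyticOnNhd_reflectionCoeff _ hu0).mul (.const _)).mul (.const _))

/-- The units topology also asks for continuity of the inverse, which comes for free from A⁻¹ =
HA*H. -/
theorem SpGroup.continuous_of_toMatrix {n : ℕ} {X : Type*} [TopologicalSpace X] {f : X → SpGroup n}
    (hf : Continuous fun x => toMatrix n (f x)) : Continuous f := by
  refine Continuous.subtype_mk (Units.continuous_iff.2 ⟨hf, ?_⟩) fun x => (f x).2
  have : Continuous fun x => toMatrix n (f x)⁻¹ := by
    simp only [toMatrix_inv]
    fun_prop
  exact this

theorem continuous_reflectionCurve {n : ℕ} (V : Matrix (Fin (n + 1)) (Fin 1) ℍ[ℝ]) (u : ℍ[ℝ])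
    (hu : star u = -u) (hu0 : u ≠ 0) : Continuous (reflectionCurve V u hu hu0) :=
  SpGroup.continuous_of_toMatrix <| continuous_matrix fun i j =>
    continuousOn_univ.1 (analyticEntries_reflectionCurve V u hu hu0 i j).continuousOn

theorem reflectionCurve_zero {n : ℕ} (V : Matrix (Fin (n + 1)) (Fin 1) ℍ[ℝ]) (u : ℍ[ℝ])
    (hu : star u = -u) (hu0 : u ≠ 0) : reflectionCurve V u hu hu0 0 = 1 := by
  apply SpGroup.toMatrix_injective
  have h : reflectionCoeff (formNorm V) u 0 = 0 := by simp [reflectionCoeff]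
  have h' : scalarMatrix 0 = 0 := by ext i j : 1; simp [scalarMatrix]
  rw [reflectionCurve, SpGroup.toMatrix_ofMatrix, h, quasiReflection, h', map_one]
  simp

/-- The standard curves in `Sp(n,1)`. -/
def reflectionCurves (n : ℕ) : Set (ℝ → SpGroup n) :=
  {γ | ∃ V u hu hu0, reflectionCurve V u hu hu0 = γ}

theorem closure_reflectionCurves {n : ℕ} (hn : 1 ≤ n) :
    Submonoid.closure {g | ∃ γ ∈ reflectionCurves n, ∃ t, γ t = g} = ⊤ := by
  rw [eq_top_iff]
  intro A _
  have h1 := mem_reflectionMonoid hn (SpGroup.toMatrix_form A)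
  have h2 : reflectionMonoid n ≤ (Submonoid.closure
      {g | ∃ γ ∈ reflectionCurves n, ∃ t, γ t = g}).map (SpGroup.toMatrix n) := by
    rw [reflectionMonoid, Submonoid.closure_le]
    rintro _ ⟨V, u, t, hu, hu0, rfl⟩
    exact ⟨reflectionCurve V u hu hu0 t,
      Submonoid.subset_closure ⟨_, ⟨V, u, hu, hu0, rfl⟩, t, rfl⟩, rfl⟩
  obtain ⟨B, hB, hBA⟩ := h2 h1
  rwa [← SpGroup.toMatrix_injective n hBA]

/-- The standard curves in the factors of `PSp(n,1)^k`. -/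
def factorCurves (n k : ℕ) : Set (ℝ → Fin k → PSpGroup n) :=
  {c | ∃ i, ∃ γ ∈ reflectionCurves n, (fun t => Pi.mulSingle i (PSpGroup.mk n (γ t))) = c}

theorem closure_factorCurves {n k : ℕ} (hn : 1 ≤ n) :
    Submonoid.closure {g | ∃ c ∈ factorCurves n k, ∃ t, c t = g} = ⊤ := by
  rw [eq_top_iff, ← Submonoid.pi_top Set.univ, Submonoid.pi_le_iff]
  intro i
  rw [Submonoid.map_le_iff_le_comap]
  intro g _
  obtain ⟨A, rfl⟩ := PSpGroup.mk_surjective n g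
  have hA : A ∈ Submonoid.closure {g | ∃ γ ∈ reflectionCurves n, ∃ t, γ t = g} := by
    rw [closure_reflectionCurves hn]; trivial
  induction hA using Submonoid.closure_induction with
  | mem A hA =>
    obtain ⟨γ, hγ, t, rfl⟩ := hA
    exact Submonoid.subset_closure ⟨_, ⟨i, γ, hγ, rfl⟩, t, rfl⟩
  | one => rw [map_one]; exact Submonoid.one_mem _
  | mul A B _ _ hA hB =>
    rw [map_mul]
    exact Submonoid.mul_mem _ (hA trivial) (hB trivial)

/-- Each coordinate of the translated curve lifts to Sp(n,1) with analytic entries: it moves in one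
factor and is constant in the others. -/
theorem reversalFun_dichotomy {n k : ℕ} (a b : Fin k) {c : ℝ → Fin k → PSpGroup n}
    (hc : c ∈ factorCurves n k) (g x : Fin k → PSpGroup n) :
    (∀ t, reversalFun ((g * c t * x) a) ((g * c t * x) b) = 0) ∨
      ∀ᵐ t, reversalFun ((g * c t * x) a) ((g * c t * x) b) ≠ 0 := by
  obtain ⟨i, γ, ⟨V, u, hu, hu0, rfl⟩, rfl⟩ := hc
  choose G hG using fun j => PSpGroup.mk_surjective n (g j)
  choose X hX using fun j => PSpGroup.mk_surjective n (x j)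
  have key : ∀ j, ∃ A : ℝ → SpGroup n, AnalyticEntries (fun t => SpGroup.toMatrix n (A t)) ∧
      ∀ t, g j * (Pi.mulSingle i (PSpGroup.mk n (reflectionCurve V u hu hu0 t)) :
        Fin k → PSpGroup n) j * x j = PSpGroup.mk n (A t) := by
    intro j
    by_cases hj : j = i
    · subst hj
      refine ⟨fun t => G j * reflectionCurve V u hu hu0 t * X j, ?_, fun t => ?_⟩
      · simp only [map_mul]
        exact ((AnalyticEntries.const _).mul (analyticEntries_reflectionCurve V u hu hu0)).mul
          (.const _)
      · simp [hG, hX]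
    · refine ⟨fun t => G j * X j, AnalyticEntries.const _, fun t => ?_⟩
      simp [hG, hX, hj]
  obtain ⟨A, hA, hA'⟩ := key a
  obtain ⟨B, hB, hB'⟩ := key b
  simp only [Pi.mul_apply, hA', hB', reversalFun_mk]
  exact (hA.reversalPoly hB).forall_eq_zero_or_ae_ne_zero

end

/-! ### Conclusion: two coordinates suffice -/

theorem mainTheorem9 (n k : ℕ) (hn : 1 ≤ n) (hk : 2 ≤ k)
    (μ : MeasureTheory.Measure (Fin k → PSpGroup n)) [μ.IsHaarMeasure] :
    μ {g : Fin k → PSpGroup n | IsStronglyReversible g} = 0 := by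
  let a : Fin k := ⟨0, by omega⟩
  let b : Fin k := ⟨1, by omega⟩
  have hab : a ≠ b := by simp [a, b]
  refine MeasureTheory.measure_mono_null (t := {g | reversalFun (g a) (g b) = 0}) ?_ ?_
  · rintro g ⟨h, -, hg⟩
    exact reversalFun_eq_zero (hg a) (hg b)
  refine measure_eq_zero_of_curve_dichotomy μ (Γ := factorCurves n k) ?_ (closure_factorCurves hn)
    ?_ (fun c hc g x => reversalFun_dichotomy a b hc g x) ?_
  · rintro _ ⟨i, _, ⟨V, u, hu, hu0, rfl⟩, rfl⟩
    refine ⟨?_, ?_⟩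
    · exact (continuous_mulSingle i).comp ((PSpGroup.isOpenQuotientMap_mk n).continuous.comp
        (continuous_reflectionCurve V u hu hu0))
    · simp [reflectionCurve_zero]
  · have h : IsClosed {p : PSpGroup n × PSpGroup n | reversalFun p.1 p.2 = 0} :=
      isClosed_eq (continuous_reversalFun n) continuous_const
    have h' : Continuous fun g : Fin k → PSpGroup n => (g a, g b) :=
      Continuous.prodMk (continuous_apply a) (continuous_apply b)
    exact h.preimage h'
  · obtain ⟨A, B, hAB⟩ := exists_reversalPoly_ne_zero hn
    intro h
    let g : Fin k → PSpGroup n := fun j => PSpGroup.mk n (if j = a then A else B)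
    have h1 : reversalFun (g a) (g b) = 0 := Set.eq_univ_iff_forall.1 h g
    apply hAB
    rwa [← reversalFun_mk, ← show g a = PSpGroup.mk n A by simp only [g, if_true],
      ← show g b = PSpGroup.mk n B by simp only [g, hab.symm, if_false]]
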